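/- Let $m,i$ be integers with $i\ge 1$ and $2i\le m$, let $\mathbb F=\mathbb F_{2^m}$, let $\mathrm{Tr}\colon\mathbb F\to\mathbb F_2$ be the trace, and put $d=2^{m-1}-2^{m-1-i}$. For an integer $d'\geq 1$ with $d'\le 2^m-1$, the extended binary BCH code $\mathrm{eBCH}(d')$ of length $2^m$ and designed distance $d'$ is the set of all vectors $(f(x))_{x\in\mathbb F}\in\mathbb F_2^{\mathbb F}$, where $f\in\mathbb F[X]$ is a polynomial of degree at most $2^m-d'$ with $f(x)\in\mathbb F_2$ for every $x\in\mathbb F$. For a function $g\colon\mathbb F_2^m\to\mathbb F_2$ and an (ordered) basis $B=(b_1,\dots,b_m)$ of $\mathbb F$ over $\mathbb F_2$, let $g_B\colon\mathbb F\to\mathbb F_2$ be defined by $g_B(x_1b_1+\dots+x_mb_m)=g(x_1,\dots,x_m)$; it is identified with its evaluation vector $(g_B(x))_{x\in\mathbb F}$. The dual basis of $B$ is the basis $B'=(b_1',\dots,b_m')$ determined by $\mathrm{Tr}(b_jb_k')=1$ if $j=k$ and $\mathrm{Tr}(b_jb_k')=0$ if $j\neq k$. Let $g\in\mathbb F_2[X_1,\dots,X_m]$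 be an $\mathbb F_2$-linear combination of products of at most two distinct variables (including the empty product $1$), and suppose that there is a basis $D$ of $\mathbb F$ over $\mathbb F_2$ such that $g_D$ lies in $\mathrm{eBCH}(d)$ and has Hamming weight $d=2^{m-1}-2^{m-1-i}$. Then there is a basis $E$ of $\mathbb F$ over $\mathbb F_2$ such that, for $$h(x_1,\dots,x_m)=x_1x_2+x_3x_4+\dots+x_{2i-1}x_{2i},$$ $h_E$ lies in $\mathrm{eBCH}(d)$, and the first $2i$ elements $e_1',\dots,e_{2i}'$ of the dual basis of $E$ satisfy $$\sum_{\substack{1\le j\le 2i-1\\ j\text{ odd}}}\Big((e_j')^{2^\ell}e_{j+1}'+e_j'(e_{j+1}')^{2^\ell}\Big)=0,\qquad \ell=1,2,\dots,i-1.$$ -/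

import Mathlib

open scoped Polynomial

/-- For a finite field `F` with `q = n + 1` elements, containing `𝔽₂`: the polynomials over `F` of
degree at most `n - d` that take values in `𝔽₂` at all nonzero points of `F`. -/
def bchPolys (F : Type*) [Field F] [Fintype F] [Algebra (ZMod 2) F] (d : ℕ) : Set F[X] :=
  {f | f.natDegree ≤ (Fintype.card F - 1) - d ∧
    ∀ x : F, x ≠ 0 → f.eval x ∈ Set.range (algebraMap (ZMod 2) F)}

/-- The extended binary BCH code of length `|F|` and designed distance `d`. The coordinates of a
word are labelled by the elements of `F`. -/
def eBCH (F : Type*) [Field F] [Fintype F] [Algebra (ZMod 2) F] (d : ℕ) : Set (F → ZMod 2) :=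
  {c | ∃ f ∈ bchPolys F (d - 1), ∀ x : F, algebraMap (ZMod 2) F (c x) = f.eval x}

/-- `𝔽₂[X₁, …, X_m]_{≤ r}`: the `𝔽₂`-span of the products of at most `r` distinct variables
(the empty product `1` included). -/
noncomputable def multilinearPolys (m r : ℕ) : Submodule (ZMod 2) (MvPolynomial (Fin m) (ZMod 2)) :=
  Submodule.span (ZMod 2)
    {p | ∃ s : Finset (Fin m), s.card ≤ r ∧ p = ∏ j ∈ s, MvPolynomial.X j}

/-- The function `F → 𝔽₂`, `x₁ b₁ + ⋯ + x_m b_m ↦ g (x₁, …, x_m)`, induced by a function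
`g : 𝔽₂ᵐ → 𝔽₂` through the (ordered) basis `B` of `F` over `𝔽₂`. -/
noncomputable def viaBasis {F : Type*} [Field F] [Algebra (ZMod 2) F] {m : ℕ}
    (g : (Fin m → ZMod 2) → ZMod 2) (B : Module.Basis (Fin m) (ZMod 2) F) : F → ZMod 2 :=
  fun x => g (B.equivFun x)

/-- The Boolean function `x₁x₂ + x₃x₄ + ⋯ + x_{2i-1}x_{2i}` in `m ≥ 2i` variables
(numbered from `0` here). -/
def pairForm {m i : ℕ} (him : 2 * i ≤ m) (x : Fin m → ZMod 2) : ZMod 2 :=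
  ∑ j : Fin i, x ⟨2 * j, by omega⟩ * x ⟨2 * j + 1, by omega⟩

/-- The system of `i - 1` equations
`∑_{j = 1, 3, …, 2i-1} (b_j ^ 2^ℓ * b_{j+1} + b_j * b_{j+1} ^ 2^ℓ) = 0`, `ℓ = 1, …, i - 1`,
in the unknowns `b₁, …, b_{2i}` (numbered from `0` here). -/
def SolvesSystem {F : Type*} [Field F] {i : ℕ} (b : Fin (2 * i) → F) : Prop :=
  ∀ ℓ : ℕ, 1 ≤ ℓ → ℓ ≤ i - 1 →
    ∑ j : Fin i,
      (b ⟨2 * j, by omega⟩ ^ 2 ^ ℓ * b ⟨2 * j + 1, by omega⟩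
        + b ⟨2 * j, by omega⟩ * b ⟨2 * j + 1, by omega⟩ ^ 2 ^ ℓ) = 0

/-! The word `g_D` is quadratic. Written with the fewest products of linear forms, it involves
independent forms only. Its weight makes the sum of its signs equal to `2 ^ (m - i)`. As this is
nonzero, the linear part lies in the span of the forms and a translation absorbs it; the exact value
then forces `i` products and constant term `0` (`IsSumOfProducts.exists_translate`). The code is
translation invariant, so taking these forms as coordinates of a basis `E` puts `h_E` in the code.

These coordinates are traces against the dual basis, and a product of two traces expands into
monomials of degree `2 ^ k + 2 ^ l`. The degree bound `2 ^ (m - 1) + 2 ^ (m - 1 - i)` kills the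
coefficient at `2 ^ (m - 1) + 2 ^ (m - 1 - ℓ)` for `ℓ < i`, which is a Frobenius power of the `ℓ`-th
equation's left side (`sum_pow_mul_add_mul_pow_eq_zero`). -/

/-! ### Reduction of quadratic functions to independent forms -/

section QuadraticFunctions

open Module

/-- `Q` is a sum of `r` products of two linear forms and an affine function. -/
def IsSumOfProducts {V : Type*} [AddCommGroup V] [Module (ZMod 2) V] (r : ℕ) (Q : V → ZMod 2) :
    Prop :=
  ∃ (a b : Fin r → Dual (ZMod 2) V) (c : Dual (ZMod 2) V) (ε : ZMod 2),
    ∀ x, Q x = ∑ j, a j x * b j x + c x + ε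

variable {V : Type*} [AddCommGroup V] [Module (ZMod 2) V]

theorem IsSumOfProducts.of_affine (c : Dual (ZMod 2) V) (ε : ZMod 2) :
    IsSumOfProducts 0 (fun x => c x + ε) :=
  ⟨Fin.elim0, Fin.elim0, c, ε, fun x => by simp⟩

theorem IsSumOfProducts.of_mul (a b : Dual (ZMod 2) V) :
    IsSumOfProducts 1 (fun x => a x * b x) :=
  ⟨fun _ => a, fun _ => b, 0, 0, fun x => by simp⟩

theorem IsSumOfProducts.add {r s : ℕ} {P Q : V → ZMod 2} (hP : IsSumOfProducts r P)
    (hQ : IsSumOfProducts s Q) : IsSumOfProducts (r + s) (fun x => P x + Q x) := by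
  obtain ⟨a, b, c, ε, h⟩ := hP
  obtain ⟨a', b', c', ε', h'⟩ := hQ
  refine ⟨Fin.append a a', Fin.append b b', c + c', ε + ε', fun x => ?_⟩
  simp only [h, h', Fin.sum_univ_add, Fin.append_left, Fin.append_right, LinearMap.add_apply]
  ring

theorem zmod_two_mul_self (z : ZMod 2) : z * z = z := by
  revert z; decide

theorem zmod_two_add_self (z : ZMod 2) : z + z = 0 := CharTwo.add_self_eq_zero z

/-- A linear dependency among the linear forms makes one of the products superfluous. -/
theorem IsSumOfProducts.of_dependent {n : ℕ} {Q : V → ZMod 2} {a b : Fin (n + 1) → Dual (ZMod 2) V}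
    {c : Dual (ZMod 2) V} {ε : ZMod 2} (hQ : ∀ x, Q x = ∑ j, a j x * b j x + c x + ε)
    {u v : Fin (n + 1) → ZMod 2} (huv : ∑ j, u j • a j + ∑ j, v j • b j = 0)
    {k : Fin (n + 1)} (hk : v k ≠ 0) : IsSumOfProducts n Q := by
  have hk1 : v k = 1 := by
    revert hk; generalize v k = z; revert z; decide
  have hb : ∀ x, b k x = u k * a k x + ∑ j, u (k.succAbove j) * a (k.succAbove j) x
      + ∑ j, v (k.succAbove j) * b (k.succAbove j) x := fun x => by
    have h := LinearMap.congr_fun huv x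
    simp only [LinearMap.add_apply, LinearMap.sum_apply, LinearMap.smul_apply, smul_eq_mul,
      LinearMap.zero_apply] at h
    rw [Fin.sum_univ_succAbove _ k, Fin.sum_univ_succAbove (fun j => v j * b j x) k, hk1] at h
    rw [← CharTwo.add_eq_zero]
    linear_combination h
  -- Substituting for `b k` in `a k * b k` leaves cross terms with `a k`, absorbed by completing the
  -- other products; what remains is a multiple of `a k ^ 2 = a k`, hence linear.
  refine ⟨fun j => a (k.succAbove j) + v (k.succAbove j) • a k,
    fun j => b (k.succAbove j) + u (k.succAbove j) • a k,
    c + (u k + ∑ j, u (k.succAbove j) * v (k.succAbove j)) • a k, ε, fun x => ?_⟩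
  rw [hQ, Fin.sum_univ_succAbove _ k, hb]
  simp only [LinearMap.add_apply, LinearMap.smul_apply, smul_eq_mul]
  have hs : ∀ j, (a (k.succAbove j) x + v (k.succAbove j) * a k x) *
      (b (k.succAbove j) x + u (k.succAbove j) * a k x) =
      a (k.succAbove j) x * b (k.succAbove j) x
        + a k x * (u (k.succAbove j) * a (k.succAbove j) x)
        + a k x * (v (k.succAbove j) * b (k.succAbove j) x)
        + a k x * (u (k.succAbove j) * v (k.succAbove j)) := fun j => by
    linear_combination u (k.succAbove j) * v (k.succAbove j) * zmod_two_mul_self (a k x)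
  simp only [hs, Finset.sum_add_distrib, ← Finset.mul_sum]
  linear_combination u k * zmod_two_mul_self (a k x)
    - a k x * zmod_two_add_self (∑ j, u (k.succAbove j) * v (k.succAbove j))

/-- A sum of products of linear forms can be written with linearly independent ones. -/
theorem IsSumOfProducts.exists_linearIndependent {s : ℕ} {Q : V → ZMod 2}
    (hQ : IsSumOfProducts s Q) :
    ∃ (r : ℕ) (a b : Fin r → Dual (ZMod 2) V) (c : Dual (ZMod 2) V) (ε : ZMod 2),
      LinearIndependent (ZMod 2) (Sum.elim a b) ∧ ∀ x, Q x = ∑ j, a j x * b j x + c x + ε := by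
  classical
  have hex : ∃ r, IsSumOfProducts r Q := ⟨s, hQ⟩
  obtain ⟨r, hr⟩ : ∃ r, r = Nat.find hex := ⟨_, rfl⟩
  have hmin : ∀ n < r, ¬ IsSumOfProducts n Q := fun n hn => Nat.find_min hex (hr ▸ hn)
  obtain ⟨a, b, c, ε, h⟩ : IsSumOfProducts r Q := hr ▸ Nat.find_spec hex
  refine ⟨r, a, b, c, ε, ?_, h⟩
  by_contra hdep
  obtain ⟨w, hw, i, hi⟩ := Fintype.not_linearIndependent_iff.1 hdep
  simp only [Fintype.sum_sum_type, Sum.elim_inl, Sum.elim_inr] at hw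
  obtain _ | n := r
  · rcases i with i | i <;> exact i.elim0
  · refine hmin n n.lt_succ_self ?_
    rcases i with i | i
    · refine IsSumOfProducts.of_dependent (a := b) (b := a) (c := c) (ε := ε) (fun x => ?_)
        ((add_comm _ _).trans hw) hi
      simp only [h, mul_comm]
    · exact IsSumOfProducts.of_dependent h hw hi

end QuadraticFunctions

/-! ### Linear forms as coordinates -/

section DualFamilies

open Module

/-- Linearly independent linear forms are part of a system of coordinates. -/
theorem exists_basis_repr_eq {K V ι κ : Type*} [Field K] [AddCommGroup V] [Module K V]
    [FiniteDimensional K V] [Fintype ι] [Fintype κ] (hκ : finrank K V = Fintype.card κ)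
    {φ : ι → Dual K V} (hφ : LinearIndependent K φ) (e : ι ↪ κ) :
    ∃ E : Basis κ K V, ∀ i x, E.repr x (e i) = φ i x := by
  classical
  obtain ⟨A, hA⟩ : ∃ A : Basis κ K (Dual K V), ∀ i, A (e i) = φ i := by
    let A' := Basis.sumExtend hφ
    have : Fintype (Basis.sumExtendIndex hφ) :=
      have := Module.Finite.finite_basis A'
      have := Finite.of_injective (Sum.inr : Basis.sumExtendIndex hφ → ι ⊕ _) Sum.inr_injective
      Fintype.ofFinite _
    have hc : Fintype.card ι + Fintype.card (Basis.sumExtendIndex hφ) = Fintype.card κ := by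
      rw [← Fintype.card_sum, ← finrank_eq_card_basis A', Subspace.dual_finrank_eq, hκ]
    have hc' : Fintype.card (Basis.sumExtendIndex hφ)
        = Fintype.card ((Set.range e)ᶜ : Set κ) := by
      rw [Fintype.card_compl_set, Set.card_range_of_injective e.injective]
      omega
    let f : ι ⊕ Basis.sumExtendIndex hφ ≃ κ :=
      (Equiv.sumCongr (Equiv.ofInjective e e.injective) (Fintype.equivOfCardEq hc')).trans
        (Equiv.Set.sumCompl (Set.range e))
    refine ⟨A'.reindex f, fun i => ?_⟩
    have hf : f.symm (e i) = Sum.inl i := by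
      rw [Equiv.symm_apply_eq]; rfl
    rw [Basis.reindex_apply, hf]
    simp only [A', Basis.sumExtend, Basis.reindex_apply, Basis.extend_apply_self]
    rfl
  have hinj : Function.Injective (LinearMap.pi A : V →ₗ[K] κ → K) := by
    rw [← LinearMap.ker_eq_bot, LinearMap.ker_eq_bot']
    intro x hx
    refine (Module.forall_dual_apply_eq_zero_iff K x).1 fun f => ?_
    have hx' : ∀ k, A k x = 0 := fun k => congr_fun hx k
    rw [← A.sum_repr f, LinearMap.sum_apply]
    exact Finset.sum_eq_zero fun k _ => by rw [LinearMap.smul_apply, hx', smul_zero]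
  have hfr : finrank K V = finrank K (κ → K) := by simp [hκ]
  refine ⟨Basis.ofEquivFun (LinearEquiv.ofInjectiveOfFinrankEq _ hinj hfr), fun i x => ?_⟩
  rw [← hA, ← Basis.equivFun_apply, Basis.equivFun_ofEquivFun]
  rfl

theorem LinearIndependent.exists_forall_dual_apply_eq {K V ι : Type*} [Field K] [AddCommGroup V]
    [Module K V] [FiniteDimensional K V] [Fintype ι] {φ : ι → Dual K V}
    (hφ : LinearIndependent K φ) (w : ι → K) : ∃ x, ∀ i, φ i x = w i := by
  have hle : Fintype.card ι ≤ Fintype.card (Fin (finrank K V)) := by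
    simpa using hφ.fintype_card_le_finrank
  obtain ⟨e⟩ := Function.Embedding.nonempty_of_card_le hle
  obtain ⟨E, hE⟩ := exists_basis_repr_eq (by simp) hφ e
  refine ⟨E.equivFun.symm (Function.extend e w 0), fun i => ?_⟩
  rw [← hE, ← E.equivFun_apply, LinearEquiv.apply_symm_apply, e.injective.extend_apply]

end DualFamilies

/-! ### Sign sums and weights -/

section CharacterSums

open Module

/-- The sign `(-1)^z` of `z ∈ 𝔽₂`. -/
def binarySign (z : ZMod 2) : ℤ := if z = 0 then 1 else -1

theorem binarySign_add (y z : ZMod 2) : binarySign (y + z) = binarySign y * binarySign z := by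
  revert y z; decide

theorem binarySign_sum {ι : Type*} (s : Finset ι) (f : ι → ZMod 2) :
    binarySign (∑ j ∈ s, f j) = ∏ j ∈ s, binarySign (f j) := by
  classical
  induction s using Finset.induction_on with
  | empty => rfl
  | insert j s hj ih => rw [Finset.sum_insert hj, Finset.prod_insert hj, binarySign_add, ih]

theorem sum_binarySign_eq_card_sub_hammingNorm {V : Type*} [Fintype V] (Q : V → ZMod 2) :
    ∑ x, binarySign (Q x) = Fintype.card V - 2 * (hammingNorm Q : ℤ) := by
  have h : ∀ z : ZMod 2, binarySign z = 1 - 2 * (if z ≠ 0 then 1 else 0) := by decide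
  simp only [h, Finset.sum_sub_distrib, ← Finset.mul_sum, Finset.sum_boole, hammingNorm]
  simp

theorem sum_binarySign_pi (r : ℕ) :
    ∑ p : Fin r → ZMod 2 × ZMod 2, binarySign (∑ j, (p j).1 * (p j).2) = 2 ^ r := by
  simp only [binarySign_sum]
  rw [← Fintype.prod_sum (fun (_ : Fin r) (q : ZMod 2 × ZMod 2) => binarySign (q.1 * q.2))]
  have h : ∑ q : ZMod 2 × ZMod 2, binarySign (q.1 * q.2) = 2 := by decide
  simp [h]

/-- A function that some translation complements is balanced. -/
theorem sum_binarySign_eq_zero {V : Type*} [AddCommGroup V] [Fintype V] {Q : V → ZMod 2} (v : V)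
    (hv : ∀ x, Q (x + v) = Q x + 1) :
    ∑ x, binarySign (Q x) = 0 := by
  have h := Fintype.sum_equiv (Equiv.addRight v) (fun x => binarySign (Q (x + v)))
    (fun x => binarySign (Q x)) fun _ => rfl
  simp only [hv, binarySign_add, ← Finset.sum_mul] at h
  have h1 : binarySign 1 = -1 := rfl
  rw [h1] at h
  linarith

variable {V : Type*} [AddCommGroup V] [Module (ZMod 2) V] [Fintype V]

/-- By independence, `x ↦ (a j x, b j x)` is onto with fibres of equal size `N`, so `|V| = N * 4 ^
r` while the sum is `± N * 2 ^ r`. -/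
theorem two_pow_mul_sum_binarySign {r : ℕ} {a b : Fin r → Dual (ZMod 2) V}
    (hab : LinearIndependent (ZMod 2) (Sum.elim a b)) (ε : ZMod 2) :
    2 ^ r * ∑ x, binarySign (∑ j, a j x * b j x + ε) = Fintype.card V * binarySign ε := by
  classical
  let Φ : V →+ (Fin r → ZMod 2 × ZMod 2) :=
    { toFun := fun x j => (a j x, b j x)
      map_zero' := by ext <;> simp
      map_add' := fun x y => by ext <;> simp }
  have hΦ : Function.Surjective Φ := fun p => by
    obtain ⟨x, hx⟩ := hab.exists_forall_dual_apply_eq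
      (Sum.elim (fun j => (p j).1) (fun j => (p j).2))
    exact ⟨x, funext fun j => Prod.ext (hx (.inl j)) (hx (.inr j))⟩
  obtain ⟨N, hN⟩ : ∃ N : ℕ, ∀ p, (Finset.univ.filter fun x => Φ x = p).card = N :=
    ⟨_, fun p => AddMonoidHom.card_fiber_eq_of_mem_range Φ (hΦ p) (hΦ 0)⟩
  have hsum : ∀ f : (Fin r → ZMod 2 × ZMod 2) → ℤ, ∑ x, f (Φ x) = N * ∑ p, f p := fun f => by
    rw [← Finset.sum_fiberwise Finset.univ Φ, Finset.mul_sum]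
    refine Finset.sum_congr rfl fun p _ => ?_
    rw [Finset.sum_congr rfl (g := fun _ => f p) fun x hx => by rw [(Finset.mem_filter.1 hx).2],
      Finset.sum_const, hN, nsmul_eq_mul]
  have h1 := hsum fun _ => 1
  have h2 := hsum fun p => binarySign (∑ j, (p j).1 * (p j).2)
  rw [sum_binarySign_pi] at h2
  have hV : (Fintype.card V : ℤ) = N * (2 ^ r * 2 ^ r) := by
    simpa [← mul_pow] using h1
  simp only [binarySign_add, ← Finset.sum_mul]
  rw [hV]
  have h2' : ∑ x, binarySign (∑ j, a j x * b j x) = N * 2 ^ r := h2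
  rw [h2']
  ring

/-- A quadratic function on `𝔽₂ᵐ` of weight `2 ^ (m - 1) - 2 ^ (m - 1 - i)` is, up to translation,
a sum of `i` products of independent linear forms. -/
theorem IsSumOfProducts.exists_translate {m i s : ℕ} (hV : Fintype.card V = 2 ^ m) (hi : 1 ≤ i)
    (him : 2 * i ≤ m) {Q : V → ZMod 2} (hQ : IsSumOfProducts s Q)
    (hwt : hammingNorm Q = 2 ^ (m - 1) - 2 ^ (m - 1 - i)) :
    ∃ (a b : Fin i → Dual (ZMod 2) V) (t : V), LinearIndependent (ZMod 2) (Sum.elim a b) ∧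
      ∀ x, Q (x + t) = ∑ j, a j x * b j x := by
  have hS : ∑ x, binarySign (Q x) = 2 ^ (m - i) := by
    rw [sum_binarySign_eq_card_sub_hammingNorm, hV, hwt,
      Nat.cast_sub (Nat.pow_le_pow_right two_pos (Nat.sub_le _ _))]
    obtain ⟨n, rfl⟩ : ∃ n, m = n + i + 1 := ⟨m - i - 1, by omega⟩
    rw [show n + i + 1 - 1 = n + i by omega, Nat.add_sub_cancel,
      show n + i + 1 - i = n + 1 by omega]
    push_cast
    ring
  obtain ⟨r, a, b, c, ε, hab, h⟩ := hQ.exists_linearIndependent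
  -- Otherwise some `v` is killed by all `a j`, `b j` but not by `c`; translation by `v` complements
  -- `Q`, and the sum vanishes.
  have hc : c ∈ Submodule.span (ZMod 2) (Set.range (Sum.elim a b)) := by
    refine FiniteDimensional.mem_span_of_iInf_ker_le_ker fun v hv => ?_
    by_contra hcv
    simp only [Submodule.mem_iInf, LinearMap.mem_ker] at hv
    have hcv1 : c v = 1 := by
      rw [LinearMap.mem_ker] at hcv
      revert hcv; generalize c v = z; revert z; decide
    have ha : ∀ j, a j v = 0 := fun j => hv (.inl j)
    have hb : ∀ j, b j v = 0 := fun j => hv (.inr j)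
    have h0 := sum_binarySign_eq_zero (Q := Q) v fun x => by
      simp only [h, map_add, ha, hb, hcv1, add_zero]; ring
    rw [hS] at h0
    exact pow_ne_zero _ two_ne_zero h0
  obtain ⟨w, hw⟩ := (Submodule.mem_span_range_iff_exists_fun (ZMod 2)).1 hc
  have hcx : ∀ x, c x = ∑ j, w (.inl j) * a j x + ∑ j, w (.inr j) * b j x := fun x => by
    rw [← hw]; simp
  -- The swap gives `a j t` the coefficient of `b j` in `c` and conversely, so the cross terms
  -- cancel `c`.
  obtain ⟨t, ht⟩ := hab.exists_forall_dual_apply_eq fun k => w k.swap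
  have hta : ∀ j, a j t = w (.inr j) := fun j => ht (.inl j)
  have htb : ∀ j, b j t = w (.inl j) := fun j => ht (.inr j)
  obtain ⟨ε', hε'⟩ : ∃ ε', ∀ x, Q (x + t) = ∑ j, a j x * b j x + ε' := by
    -- One copy comes from the products at `t`, two from `c t`.
    refine ⟨3 * ∑ j, w (.inl j) * w (.inr j) + ε, fun x => ?_⟩
    have h2 : (2 : ZMod 2) = 0 := rfl
    rw [h, hcx, Finset.mul_sum, ← Finset.sum_add_distrib, ← Finset.sum_add_distrib,
      ← add_assoc, ← Finset.sum_add_distrib]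
    congr 1
    refine Finset.sum_congr rfl fun j _ => ?_
    rw [map_add, map_add, hta, htb]
    linear_combination (w (.inl j) * a j x + w (.inr j) * b j x) * h2
  have hS' : ∑ x, binarySign (∑ j, a j x * b j x + ε') = 2 ^ (m - i) := by
    rw [← hS]
    exact Fintype.sum_equiv (Equiv.addRight t) _ _ fun x => by rw [Equiv.coe_addRight, hε']
  have key := two_pow_mul_sum_binarySign hab ε'
  rw [hS', hV, ← pow_add] at key
  have hε0 : ε' = 0 := by
    by_contra hne
    rw [binarySign, if_neg hne] at key
    push_cast at key
    have h1 : (0 : ℤ) < 2 ^ (r + (m - i)) := by positivity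
    have h2 : (0 : ℤ) < 2 ^ m := by positivity
    linarith
  have hri : r = i := by
    rw [hε0, binarySign, if_pos rfl, mul_one] at key
    have := Nat.pow_right_injective le_rfl (by exact_mod_cast key : 2 ^ (r + (m - i)) = 2 ^ m)
    omega
  subst hri
  exact ⟨a, b, t, hab, fun x => by rw [hε', hε0, add_zero]⟩

end CharacterSums

/-! ### Polynomials of degree at most two as sums of products -/

section MultilinearPolynomials

open Module

theorem exists_isSumOfProducts_viaBasis {F : Type*} [Field F] [Algebra (ZMod 2) F] {m : ℕ}
    (D : Basis (Fin m) (ZMod 2) F) {g : MvPolynomial (Fin m) (ZMod 2)}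
    (hg : g ∈ multilinearPolys m 2) :
    ∃ s, IsSumOfProducts s (viaBasis (fun x => MvPolynomial.eval x g) D) := by
  change ∃ s, IsSumOfProducts s (fun x => MvPolynomial.eval (D.equivFun x) g)
  induction hg using Submodule.span_induction with
  | mem p hp =>
    obtain ⟨s, hs, rfl⟩ := hp
    have hcases : s.card = 0 ∨ s.card = 1 ∨ s.card = 2 := by omega
    rcases hcases with h | h | h
    · rw [Finset.card_eq_zero] at h
      subst h
      exact ⟨0, by simpa using IsSumOfProducts.of_affine (0 : Dual (ZMod 2) F) 1⟩
    · obtain ⟨j, rfl⟩ := Finset.card_eq_one.1 h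
      exact ⟨0, by simpa using IsSumOfProducts.of_affine (D.coord j) 0⟩
    · obtain ⟨j, k, hjk, rfl⟩ := Finset.card_eq_two.1 h
      refine ⟨1, ?_⟩
      have := IsSumOfProducts.of_mul (D.coord j) (D.coord k)
      simpa [Finset.prod_pair hjk] using this
  | zero => exact ⟨0, by simpa using IsSumOfProducts.of_affine (0 : Dual (ZMod 2) F) 0⟩
  | add p q _ _ hp hq =>
    obtain ⟨s, hs⟩ := hp
    obtain ⟨t, ht⟩ := hq
    exact ⟨s + t, by simpa using hs.add ht⟩
  | smul z p _ hp =>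
    have hz : z = 0 ∨ z = 1 := by revert z; decide
    rcases hz with rfl | rfl
    · exact ⟨0, by simpa using IsSumOfProducts.of_affine (0 : Dual (ZMod 2) F) 0⟩
    · simpa using hp

end MultilinearPolynomials

/-! ### Trace polynomials and the degree bound -/

section BCH

open Polynomial

variable {F : Type*} [Field F]

theorem two_pow_add_two_pow_eq_iff {n b k l : ℕ} (hb : b < n) (hk : k ≤ n) (hl : l ≤ n) :
    2 ^ n + 2 ^ b = 2 ^ k + 2 ^ l ↔ k = n ∧ l = b ∨ k = b ∧ l = n := by
  constructor
  · intro h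
    rcases hk.eq_or_lt with rfl | hk
    · exact .inl ⟨rfl, (Nat.pow_right_injective le_rfl (Nat.add_left_cancel h)).symm⟩
    rcases hl.eq_or_lt with rfl | hl
    · rw [add_comm] at h
      exact .inr ⟨(Nat.pow_right_injective le_rfl (Nat.add_right_cancel h)).symm, rfl⟩
    · exfalso
      obtain ⟨n, rfl⟩ : ∃ n', n = n' + 1 := ⟨n - 1, by omega⟩
      have h1 : 2 ^ k ≤ 2 ^ n := Nat.pow_le_pow_right two_pos (by omega)
      have h2 : 2 ^ l ≤ 2 ^ n := Nat.pow_le_pow_right two_pos (by omega)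
      have h3 : 0 < 2 ^ b := by positivity
      rw [pow_succ] at h
      omega
  · rintro (⟨rfl, rfl⟩ | ⟨rfl, rfl⟩)
    · rfl
    · exact add_comm _ _

/-- The polynomial of the function `x ↦ Tr (u x) Tr (v x)` on the field with `2 ^ m` elements. -/
noncomputable def traceMulPoly (m : ℕ) (u v : F) : F[X] :=
  ∑ k ∈ Finset.range m, ∑ l ∈ Finset.range m, C (u ^ 2 ^ k * v ^ 2 ^ l) * X ^ (2 ^ k + 2 ^ l)

theorem natDegree_traceMulPoly_le (m : ℕ) (u v : F) : (traceMulPoly m u v).natDegree ≤ 2 ^ m := by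
  refine natDegree_sum_le_of_forall_le _ _ fun k hk =>
    natDegree_sum_le_of_forall_le _ _ fun l hl => (natDegree_C_mul_X_pow_le _ _).trans ?_
  rw [Finset.mem_range] at hk hl
  obtain ⟨n, rfl⟩ : ∃ n, m = n + 1 := ⟨m - 1, by omega⟩
  have h1 : 2 ^ k ≤ 2 ^ n := Nat.pow_le_pow_right two_pos (by omega)
  have h2 : 2 ^ l ≤ 2 ^ n := Nat.pow_le_pow_right two_pos (by omega)
  rw [pow_succ]
  omega

theorem coeff_traceMulPoly {n b : ℕ} (hb : b < n) (u v : F) :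
    (traceMulPoly (n + 1) u v).coeff (2 ^ n + 2 ^ b)
      = u ^ 2 ^ n * v ^ 2 ^ b + u ^ 2 ^ b * v ^ 2 ^ n := by
  have hterm : ∀ k ∈ Finset.range (n + 1), ∀ l ∈ Finset.range (n + 1),
      (C (u ^ 2 ^ k * v ^ 2 ^ l) * X ^ (2 ^ k + 2 ^ l) : F[X]).coeff (2 ^ n + 2 ^ b)
        = (if k = n then if l = b then u ^ 2 ^ n * v ^ 2 ^ b else 0 else 0)
          + (if k = b then if l = n then u ^ 2 ^ b * v ^ 2 ^ n else 0 else 0) := by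
    intro k hk l hl
    rw [Finset.mem_range, Nat.lt_succ_iff] at hk hl
    rw [coeff_C_mul_X_pow]
    simp only [two_pow_add_two_pow_eq_iff hb hk hl]
    have := hb.ne
    have := hb.ne'
    by_cases h1 : k = n <;> by_cases h2 : l = b <;> by_cases h3 : k = b <;> by_cases h4 : l = n <;>
      simp_all
  rw [traceMulPoly, finsetSum_coeff]
  simp only [finsetSum_coeff]
  rw [Finset.sum_congr rfl fun k hk => Finset.sum_congr rfl (hterm k hk)]
  have hbn : b < n + 1 := by omega
  simp [Finset.sum_add_distrib, hbn]

variable [Fintype F]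

/-- Polynomials of degree at most `q` that agree as functions have the same coefficients at
`2, …, q - 1`. -/
theorem coeff_eq_of_forall_eval_eq {p f : F[X]} (hp : p.natDegree ≤ Fintype.card F)
    (hf : f.natDegree ≤ Fintype.card F) (h : ∀ x, p.eval x = f.eval x) {e : ℕ} (he : 1 < e)
    (heq : e < Fintype.card F) : p.coeff e = f.coeff e := by
  have hq : 1 < Fintype.card F := Fintype.one_lt_card
  -- `X ^ q - X` vanishes on `F` and has coefficients only at `q` and `1`; removing the top term
  -- leaves degree below `q` with `q` roots.
  let R := p - f - C ((p - f).coeff (Fintype.card F)) * (X ^ Fintype.card F - X)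
  have hX : (X ^ Fintype.card F - X : F[X]).natDegree = Fintype.card F :=
    FiniteField.X_pow_card_sub_X_natDegree_eq F hq
  have hle : R.natDegree ≤ Fintype.card F :=
    (natDegree_sub_le _ _).trans (max_le ((natDegree_sub_le _ _).trans (max_le hp hf))
      ((natDegree_C_mul_le _ _).trans hX.le))
  have hcoeff : R.coeff (Fintype.card F) = 0 := by
    rw [coeff_sub, coeff_C_mul, coeff_sub (X ^ _), coeff_X_pow_self, coeff_X, if_neg hq.ne, sub_zero,
      mul_one, sub_self]
  have hlt : R.natDegree < Fintype.card F := by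
    refine lt_of_le_of_ne hle fun hR => ?_
    have h0 : R = 0 := by
      rw [← leadingCoeff_eq_zero, leadingCoeff, hR, hcoeff]
    rw [h0, natDegree_zero] at hR
    omega
  have hR : R = 0 := eq_zero_of_natDegree_lt_card_of_eval_eq_zero' R Finset.univ
    (fun x _ => by simp [R, h, FiniteField.pow_card]) (by simpa using hlt)
  have hc := congrArg (fun r => coeff r e) hR
  simp only [R, coeff_sub, coeff_C_mul, coeff_X_pow, heq.ne, coeff_X, he.ne, if_false,
    coeff_zero, sub_zero, mul_zero] at hc
  exact sub_eq_zero.1 hc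

variable [Algebra (ZMod 2) F]

theorem eBCH_translate {d : ℕ} {c : F → ZMod 2} (hc : c ∈ eBCH F d) (t : F) :
    (fun x => c (x + t)) ∈ eBCH F d := by
  obtain ⟨f, ⟨hdeg, -⟩, hf⟩ := hc
  have h : ∀ x, algebraMap (ZMod 2) F (c (x + t)) = (f.comp (X + C t)).eval x := fun x => by
    rw [hf, eval_comp, eval_add, eval_X, eval_C]
  refine ⟨f.comp (X + C t), ⟨?_, fun x _ => ⟨_, h x⟩⟩, h⟩
  rwa [natDegree_comp, natDegree_X_add_C, mul_one]

theorem eval_traceMulPoly {m : ℕ} (hF : Fintype.card F = 2 ^ m) (u v x : F) :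
    (traceMulPoly m u v).eval x = algebraMap (ZMod 2) F
      (Algebra.trace (ZMod 2) F (u * x) * Algebra.trace (ZMod 2) F (v * x)) := by
  have hm : Module.finrank (ZMod 2) F = m := by
    have h := Module.card_eq_pow_finrank (K := ZMod 2) (V := F)
    rw [hF, ZMod.card] at h
    exact (Nat.pow_right_injective le_rfl h).symm
  rw [map_mul, FiniteField.algebraMap_trace_eq_sum_pow, FiniteField.algebraMap_trace_eq_sum_pow,
    hm, Nat.card_zmod, Finset.sum_mul_sum, traceMulPoly, eval_finsetSum]
  refine Finset.sum_congr rfl fun k _ => ?_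
  rw [eval_finsetSum]
  refine Finset.sum_congr rfl fun l _ => ?_
  rw [eval_mul, eval_C, eval_pow, eval_X, mul_pow, mul_pow, pow_add]
  ring

/-- If a sum of products of traces lies in the extended BCH code of designed distance
`2 ^ (m - 1) - 2 ^ (m - 1 - i)`, its monomials of high degree vanish. -/
theorem sum_pow_mul_add_mul_pow_eq_zero {m i : ℕ} (hF : Fintype.card F = 2 ^ m) (hi : 1 ≤ i)
    (him : 2 * i ≤ m) {ι : Type*} [Fintype ι] (u v : ι → F)
    (hcode : (fun x => ∑ j, Algebra.trace (ZMod 2) F (u j * x) * Algebra.trace (ZMod 2) F (v j * x))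
      ∈ eBCH F (2 ^ (m - 1) - 2 ^ (m - 1 - i))) {ℓ : ℕ} (hℓ : 1 ≤ ℓ) (hℓi : ℓ ≤ i - 1) :
    ∑ j, (u j ^ 2 ^ ℓ * v j + u j * v j ^ 2 ^ ℓ) = 0 := by
  have : CharP F 2 := charP_of_injective_algebraMap (algebraMap (ZMod 2) F).injective 2
  obtain ⟨f, ⟨hdeg, -⟩, hf⟩ := hcode
  obtain ⟨n, rfl⟩ : ∃ n, m = n + 1 := ⟨m - 1, by omega⟩
  obtain ⟨b, rfl⟩ : ∃ b, n = b + ℓ := ⟨n - ℓ, by omega⟩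
  rw [Nat.add_sub_cancel, hF] at hdeg
  have h1 : 2 ^ (b + ℓ - i) < 2 ^ b := Nat.pow_lt_pow_right one_lt_two (by omega)
  have h2 : 2 ^ b < 2 ^ (b + ℓ) := Nat.pow_lt_pow_right one_lt_two (by omega)
  have h3 : 1 ≤ 2 ^ (b + ℓ - i) := Nat.one_le_two_pow
  have h4 : 2 ^ (b + ℓ + 1) = 2 ^ (b + ℓ) + 2 ^ (b + ℓ) := by rw [pow_succ, mul_two]
  -- Here `b = m - 1 - ℓ`, and `ℓ < i` puts the exponent above the degree bound.
  have hzero : f.coeff (2 ^ (b + ℓ) + 2 ^ b) = 0 :=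
    coeff_eq_zero_of_natDegree_lt (by omega)
  have hcoeff := coeff_eq_of_forall_eval_eq
    (p := ∑ j, traceMulPoly (b + ℓ + 1) (u j) (v j)) (f := f)
    (natDegree_sum_le_of_forall_le _ _ fun j _ =>
      (natDegree_traceMulPoly_le _ _ _).trans hF.ge)
    (by omega) (fun x => by rw [← hf, map_sum, eval_finsetSum]; simp only [eval_traceMulPoly hF])
    (e := 2 ^ (b + ℓ) + 2 ^ b) (by omega) (by omega)
  rw [hzero, finsetSum_coeff] at hcoeff
  simp only [coeff_traceMulPoly (show b < b + ℓ by omega)] at hcoeff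
  -- The coefficient is the `2 ^ b`-th power of the desired sum.
  refine eq_zero_of_pow_eq_zero (n := 2 ^ b) ?_
  rw [sum_pow_char_pow, ← hcoeff]
  refine Finset.sum_congr rfl fun j _ => ?_
  rw [add_pow_char_pow, mul_pow, mul_pow, ← pow_mul, ← pow_mul, ← pow_add, add_comm ℓ b]

end BCH

theorem mainTheorem4 {F : Type*} [Field F] [Fintype F] [Algebra (ZMod 2) F]
    (m i : ℕ) (hF : Fintype.card F = 2 ^ m) (hi : 1 ≤ i) (him : 2 * i ≤ m)
    (g : MvPolynomial (Fin m) (ZMod 2)) (hg : g ∈ multilinearPolys m 2)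
    (D : Module.Basis (Fin m) (ZMod 2) F)
    (hcode : viaBasis (fun x => MvPolynomial.eval x g) D
      ∈ eBCH F (2 ^ (m - 1) - 2 ^ (m - 1 - i)))
    (hweight : hammingNorm (viaBasis (fun x => MvPolynomial.eval x g) D)
      = 2 ^ (m - 1) - 2 ^ (m - 1 - i)) :
    ∃ E : Module.Basis (Fin m) (ZMod 2) F,
      viaBasis (pairForm him) E ∈ eBCH F (2 ^ (m - 1) - 2 ^ (m - 1 - i)) ∧
      SolvesSystem (fun k : Fin (2 * i) => E.traceDual (Fin.castLE him k)) := by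
  obtain ⟨s, hs⟩ := exists_isSumOfProducts_viaBasis D hg
  obtain ⟨a, b, t, hab, ht⟩ := hs.exists_translate hF hi him hweight
  let e : Fin i ⊕ Fin i ↪ Fin m :=
    { toFun := Sum.elim (fun j => ⟨2 * j, by omega⟩) (fun j => ⟨2 * j + 1, by omega⟩)
      inj' := by
        rintro (j | j) (k | k) h <;>
          simp only [Sum.elim_inl, Sum.elim_inr, Fin.mk.injEq] at h <;>
          first
          | omega
          | exact congrArg _ (Fin.ext (by omega)) }
  obtain ⟨E, hE⟩ := exists_basis_repr_eq (Module.finrank_eq_card_basis D) hab e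
  have htrans : viaBasis (pairForm him) E
      = fun x => viaBasis (fun x => MvPolynomial.eval x g) D (x + t) := by
    funext x
    rw [ht]
    change ∑ j : Fin i, _ = _
    refine Finset.sum_congr rfl fun j _ => ?_
    have h1 := hE (.inl j) x
    have h2 := hE (.inr j) x
    rw [Sum.elim_inl] at h1
    rw [Sum.elim_inr] at h2
    rw [← h1, ← h2]
    rfl
  have hmem : viaBasis (pairForm him) E ∈ eBCH F (2 ^ (m - 1) - 2 ^ (m - 1 - i)) :=
    htrans ▸ eBCH_translate hcode t
  refine ⟨E, hmem, fun ℓ hℓ hℓi => ?_⟩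
  refine sum_pow_mul_add_mul_pow_eq_zero hF hi him
    (fun j : Fin i => E.traceDual ⟨2 * j, by omega⟩)
    (fun j : Fin i => E.traceDual ⟨2 * j + 1, by omega⟩) ?_ hℓ hℓi
  -- The trace dual of the trace dual is `E` itself.
  have hrepr : ∀ k x, Algebra.trace (ZMod 2) F (E.traceDual k * x) = E.equivFun x k := fun k x => by
    have h := E.traceDual.traceDual_repr_apply x k
    rw [Module.Basis.traceDual_traceDual, Algebra.traceForm_apply] at h
    rw [Module.Basis.equivFun_apply, h, mul_comm]
  simp only [hrepr]
  exact hmem
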